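/- Conventions. Let $X$ be an infinite-dimensional complex Banach space and $T$ a bounded linear operator on $X$, with nullity $\alpha(T)=\dim\mathcal N(T)$ and defect $\beta(T)=\operatorname{codim}\mathcal R(T)$. $T$ is *upper semi-Fredholm* if $\mathcal R(T)$ is closed and $\alpha(T)<\infty$; it is *Fredholm* if moreover $\beta(T)<\infty$. $T$ is *upper semi-Weyl* if it is upper semi-Fredholm and $\operatorname{ind}(T)=\alpha(T)-\beta(T)\le 0$, and *upper semi-Browder* if it is upper semi-Fredholm with finite ascent $p(T)=\inf\{n\ge 0:\mathcal N(T^n)=\mathcal N(T^{n+1})\}$. The descent is $q(T)=\inf\{n\ge 0:\mathcal R(T^n)=\mathcal R(T^{n+1})\}$. Let $\sigma(T)$ be the spectrum of $T$, and let $\sigma_e(T)$, $\sigma_{ue}(T)$, $\sigma_{uw}(T)$, $\sigma_{ub}(T)$ be the sets of $\lambda\in\mathbb C$ such that $T-\lambda I$ is not Fredholm, not upper semi-Fredholm, not upper semi-Weyl, not upper semi-Browder, respectively. Let $\Pi^0(T)$ be the set of poles of finite rank of $T$, that is, of $\lambda\in\sigma(T)$ such that $p(T-\lambda I)<\infty$,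 $q(T-\lambda I)<\infty$ and $\alpha(T-\lambda I)<\infty$. Say that $T\in(B_e)$ if $\sigma(T)\setminus\sigma_e(T)=\Pi^0(T)$, and that $T\in(aB)$ (a-Browder's theorem holds for $T$) if $\sigma_{uw}(T)=\sigma_{ub}(T)$. Statement. On $l^2=l^2(\mathbb N)$ over $\mathbb C$ let $L(x_1,x_2,x_3,\ldots)=(x_2,x_3,\ldots)$ and $S(x_1,x_2,x_3,\ldots)=(x_1,0,x_2,0,x_3,\ldots)$, and let $T=L\oplus S$ on the Hilbert space $l^2\oplus l^2$. Then $$\sigma(T)=\sigma_e(T)=\sigma_{ub}(T)=\{\lambda\in\mathbb C:|\lambda|\le 1\},\qquad \sigma_{ue}(T)=\sigma_{uw}(T)=\{\lambda\in\mathbb C:|\lambda|=1\}.$$ Thus $T\in(B_e)$ but $T\notin(aB)$. On the other hand, $L\in(aB)$ but $L\notin(B_e)$. So the classes $(aB)$ and $(B_e)$ are independent: there is an operator on an infinite-dimensional complex Banach space that lies in $(B_e)$ but not in $(aB)$, and there is one that lies in $(aB)$ but not in $(B_e)$. -/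

import Mathlib

open scoped ENNReal

namespace OperatorClasses

noncomputable section

/-! ### Semi-Fredholm theory of bounded operators on a complex Banach space -/

section General

variable {X : Type*} [NormedAddCommGroup X] [NormedSpace ℂ X]

/-- The operator `T - λ I`. -/
def shifted (T : X →L[ℂ] X) (z : ℂ) : X →L[ℂ] X :=
  T - z • ContinuousLinearMap.id ℂ X

/-- The nullity `α(T) = dim N(T)`, a natural number or `∞`. -/
def nullity (T : X →L[ℂ] X) : ℕ∞ :=
  Cardinal.toENat (Module.rank ℂ T.ker)

/-- The defect `β(T) = codim R(T)`, a natural number or `∞`. -/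
def defect (T : X →L[ℂ] X) : ℕ∞ :=
  Cardinal.toENat (Module.rank ℂ (X ⧸ T.range))

/-- `T` is upper semi-Fredholm: its range is closed and its kernel is finite-dimensional. -/
def IsUpperSemiFredholm (T : X →L[ℂ] X) : Prop :=
  IsClosed (T.range : Set X) ∧ nullity T < ⊤

/-- `T` is lower semi-Fredholm: its range has finite codimension. -/
def IsLowerSemiFredholm (T : X →L[ℂ] X) : Prop :=
  defect T < ⊤

/-- `ind(T) = α(T) - β(T)`, an extended integer. It is only used for semi-Fredholm operators, where
at most one of the two terms is infinite. -/
def extIndex (T : X →L[ℂ] X) : EReal :=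
  (((nullity T : ℕ∞) : ℝ≥0∞) : EReal) - (((defect T : ℕ∞) : ℝ≥0∞) : EReal)

/-- `T` is upper semi-Weyl: upper semi-Fredholm with `ind(T) ≤ 0`. -/
def IsUpperSemiWeyl (T : X →L[ℂ] X) : Prop :=
  IsUpperSemiFredholm T ∧ extIndex T ≤ 0

/-- The ascent `p(T) = inf {n : N(Tⁿ) = N(Tⁿ⁺¹)}`, with `inf ∅ = ∞`. -/
def ascent (T : X →L[ℂ] X) : ℕ∞ :=
  ⨅ (n : ℕ) (_ : (T ^ n).ker = (T ^ (n + 1)).ker), (n : ℕ∞)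

/-- The descent `q(T) = inf {n : R(Tⁿ) = R(Tⁿ⁺¹)}`, with `inf ∅ = ∞`. -/
def descent (T : X →L[ℂ] X) : ℕ∞ :=
  ⨅ (n : ℕ) (_ : (T ^ n).range = (T ^ (n + 1)).range), (n : ℕ∞)

/-- `T` is upper semi-Browder: upper semi-Fredholm with finite ascent. -/
def IsUpperSemiBrowder (T : X →L[ℂ] X) : Prop :=
  IsUpperSemiFredholm T ∧ ascent T < ⊤

/-- The essential spectrum `σ_e(T)`. -/
def essSpectrum (T : X →L[ℂ] X) : Set ℂ :=
  {z | ¬ (shifted T z).IsFredholm}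

/-- The upper semi-Fredholm spectrum `σ_ue(T)`. -/
def upperSemiFredholmSpectrum (T : X →L[ℂ] X) : Set ℂ :=
  {z | ¬ IsUpperSemiFredholm (shifted T z)}

/-- The upper semi-Weyl spectrum `σ_uw(T)`. -/
def upperSemiWeylSpectrum (T : X →L[ℂ] X) : Set ℂ :=
  {z | ¬ IsUpperSemiWeyl (shifted T z)}

/-- The upper semi-Browder spectrum `σ_ub(T)`. -/
def upperSemiBrowderSpectrum (T : X →L[ℂ] X) : Set ℂ :=
  {z | ¬ IsUpperSemiBrowder (shifted T z)}

/-- `Π(T)`: the poles of the resolvent of `T`. -/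
def poles (T : X →L[ℂ] X) : Set ℂ :=
  {z | z ∈ spectrum ℂ T ∧ ascent (shifted T z) < ⊤ ∧ descent (shifted T z) < ⊤}

/-- `Π⁰(T)`: the poles `z` of `T` of finite rank, that is, with `α(T - z I) < ∞`. -/
def polesFiniteRank (T : X →L[ℂ] X) : Set ℂ :=
  {z | z ∈ poles T ∧ nullity (shifted T z) < ⊤}

variable (X)

/-- The class `(B_e)`: operators with `σ(T) \ σ_e(T) = Π⁰(T)`. -/
def classBe : Set (X →L[ℂ] X) :=
  {T | spectrum ℂ T \ essSpectrum T = polesFiniteRank T}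

/-- The class `(aB)` of operators satisfying a-Browder's theorem: `σ_uw(T) = σ_ub(T)`. -/
def classAB : Set (X →L[ℂ] X) :=
  {T | upperSemiWeylSpectrum T = upperSemiBrowderSpectrum T}

variable {X}

theorem nullity_lt_top_iff (T : X →L[ℂ] X) : nullity T < ⊤ ↔ FiniteDimensional ℂ T.ker := by
  rw [nullity, Cardinal.toENat_lt_top, Module.rank_lt_aleph0_iff]

theorem defect_lt_top_iff (T : X →L[ℂ] X) :
    defect T < ⊤ ↔ FiniteDimensional ℂ (X ⧸ T.range) := by
  rw [defect, Cardinal.toENat_lt_top, Module.rank_lt_aleph0_iff]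

/-- On a Banach space, an operator is Fredholm in Mathlib's sense if and only if it is both upper
and lower semi-Fredholm. -/
theorem isFredholm_iff [CompleteSpace X] (T : X →L[ℂ] X) :
    T.IsFredholm ↔ IsUpperSemiFredholm T ∧ IsLowerSemiFredholm T := by
  rw [IsUpperSemiFredholm, IsLowerSemiFredholm, nullity_lt_top_iff, defect_lt_top_iff]
  constructor
  · intro h
    exact ⟨⟨h.isClosed_range, h.finite_ker⟩, h.finite_coker⟩
  · rintro ⟨⟨h1, h2⟩, h3⟩
    have : CompleteSpace T.range := h1.completeSpace_coe
    have hopen : IsOpenMap (T.toLinearMap.codRestrict T.range T.toLinearMap.mem_range_self) :=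
      ContinuousLinearMap.isOpenMap (T.codRestrict T.range T.toLinearMap.mem_range_self)
        T.toLinearMap.surjective_rangeRestrict
    have hs : Topology.IsStrictMap T :=
      Topology.IsEmbedding.subtypeVal.isStrictMap_iff.1
        (hopen.isStrictMap (T.continuous.codRestrict T.toLinearMap.mem_range_self))
    exact ⟨hs, h1, h2, h3, .of_finiteDimensional _⟩

end General

/-! ### Shift, spread isometry and direct sums -/

/-- The Hilbert space `l²` of square-summable complex sequences. -/
abbrev ell2 : Type := lp (fun _ : ℕ => ℂ) 2

theorem memlp_comp_succ (x : ell2) : Memℓp (fun n : ℕ => x (n + 1)) 2 := by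
  have hx := lp.memℓp x
  rw [memℓp_gen_iff (by norm_num)] at hx ⊢
  exact hx.comp_injective (add_left_injective 1)

/-- The left shift `L (x₁, x₂, x₃, …) = (x₂, x₃, …)` on `l²`. -/
def leftShift : ell2 →L[ℂ] ell2 :=
  LinearMap.mkContinuous
    { toFun := fun x => ⟨fun n => x (n + 1), memlp_comp_succ x⟩
      map_add' := fun x y => by ext n; rfl
      map_smul' := fun c x => by ext n; simp } 1 (by
    intro x
    rw [one_mul]
    refine lp.norm_le_of_tsum_le (by norm_num) (norm_nonneg x) ?_
    have h := lp.hasSum_norm (p := 2) (by norm_num) x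
    rw [← h.tsum_eq]
    exact tsum_comp_le_tsum_of_inj h.summable (fun n => by positivity)
      (add_left_injective 1))

/-- The sequence `(x₁, 0, x₂, 0, x₃, …)`; indices start at `0` here. -/
def spreadSeq (x : ℕ → ℂ) (n : ℕ) : ℂ :=
  if Even n then x (n / 2) else 0

theorem hasSum_spreadSeq (x : ell2) :
    HasSum (fun n => ‖spreadSeq x n‖ ^ (2 : ℝ≥0∞).toReal) (‖x‖ ^ (2 : ℝ≥0∞).toReal) := by
  have h := lp.hasSum_norm (p := 2) (by norm_num) x
  have hinj : Function.Injective (fun n : ℕ => 2 * n) := fun a b hab => by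
    simpa using hab
  rw [← hinj.hasSum_iff]
  · convert h using 2 with n
    simp [spreadSeq]
  · intro n hn
    have : ¬ Even n := fun ⟨m, hm⟩ => hn ⟨m, by simp only; omega⟩
    simp [spreadSeq, this]

/-- The spread isometry `S (x₁, x₂, x₃, …) = (x₁, 0, x₂, 0, x₃, …)` on `l²`. -/
def spread : ell2 →ₗᵢ[ℂ] ell2 where
  toFun x := ⟨spreadSeq x, memℓp_gen (hasSum_spreadSeq x).summable⟩
  map_add' x y := by
    ext n
    change spreadSeq (fun k => x k + y k) n = spreadSeq x n + spreadSeq y n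
    by_cases h : Even n <;> simp [spreadSeq, h]
  map_smul' c x := by ext n; by_cases h : Even n <;> simp [spreadSeq, h]
  norm_map' x := by
    have h := lp.hasSum_norm (p := 2) (by norm_num)
      (⟨spreadSeq x, memℓp_gen (hasSum_spreadSeq x).summable⟩ : ell2)
    have h2 := h.unique (hasSum_spreadSeq x)
    exact (Real.rpow_left_inj (norm_nonneg _) (norm_nonneg _) (by norm_num)).1 h2

/-- The direct sum `A ⊕ B : (x, y) ↦ (A x, B y)` on the Hilbert space direct sum `X ⊕ Y`. -/
def directSum {X Y : Type*} [NormedAddCommGroup X] [NormedSpace ℂ X]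
    [NormedAddCommGroup Y] [NormedSpace ℂ Y] (A : X →L[ℂ] X) (B : Y →L[ℂ] Y) :
    WithLp 2 (X × Y) →L[ℂ] WithLp 2 (X × Y) :=
  ((WithLp.prodContinuousLinearEquiv 2 ℂ X Y).symm : X × Y →L[ℂ] WithLp 2 (X × Y)) ∘L
    (A.prodMap B) ∘L
      ((WithLp.prodContinuousLinearEquiv 2 ℂ X Y) : WithLp 2 (X × Y) →L[ℂ] X × Y)

theorem leftShift_apply (x : ell2) (n : ℕ) : leftShift x n = x (n + 1) := rfl

theorem spread_apply (x : ell2) (n : ℕ) :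
    spread x n = if Even n then x (n / 2) else 0 := rfl

/-- The operator `T = L ⊕ S` on `l² ⊕ l²`. -/
def exampleT : WithLp 2 (ell2 × ell2) →L[ℂ] WithLp 2 (ell2 × ell2) :=
  directSum leftShift spread.toContinuousLinearMap

end

end OperatorClasses

open OperatorClasses

/-! For |z| < 1 the two summands pull in opposite directions. `L - z` is onto with kernel spanned by
the geometric sequence `(zⁿ)`, so its index is positive. `S - z` is bounded below with range of
infinite codimension. In the sum the infinite defect pushes the index to -∞, so `T - z` is upper
semi-Weyl without being Fredholm. The ascent cannot be hidden in this way: a surjective operator of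
finite ascent is injective, so `L - z`, and with it `T - z`, has infinite ascent and is not upper
semi-Browder. For |z| = 1, `L - z` is injective with non-closed range, which excludes every
Fredholm-type property of both `L - z` and `T - z`, and also finite descent. For |z| > 1 everything
is invertible because all norms are at most 1. Hence `T` has equal spectrum and essential spectrum
and no poles, while its Weyl and Browder spectra differ. For `L` alone no infinite defect masks the
index, so both of these spectra are the closed disc; yet 0 is a Fredholm point of the spectrum of
`L` that is not a pole. -/

namespace OperatorClasses

/-! ### Ascent, descent, nullity and defect of injective and surjective operators -/

section General

variable {X : Type*} [NormedAddCommGroup X] [NormedSpace ℂ X]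

theorem shifted_apply (T : X →L[ℂ] X) (z : ℂ) (x : X) : shifted T z x = T x - z • x := rfl

theorem mem_spectrum_iff [CompleteSpace X] (T : X →L[ℂ] X) (z : ℂ) :
    z ∈ spectrum ℂ T ↔ ¬ Function.Bijective (shifted T z) := by
  have h : algebraMap ℂ (X →L[ℂ] X) z - T = -shifted T z := by
    ext x
    simp [shifted_apply, Algebra.algebraMap_eq_smul_one]
  rw [spectrum.mem_iff, h, IsUnit.neg_iff, ContinuousLinearMap.isUnit_iff_bijective]

theorem bijective_shifted_of_norm_lt [CompleteSpace X] {T : X →L[ℂ] X} {z : ℂ}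
    (hT : ‖T‖ ≤ 1) (hz : 1 < ‖z‖) : Function.Bijective (shifted T z) := by
  by_contra h
  rw [← mem_spectrum_iff] at h
  have := spectrum.norm_le_norm_mul_of_mem h
  -- Only an inequality, since the identity has norm 0 when `X` is trivial.
  have h1 : ‖(1 : X →L[ℂ] X)‖ ≤ 1 := ContinuousLinearMap.norm_id_le
  have := mul_le_mul hT h1 (norm_nonneg _) zero_le_one
  linarith

theorem ascent_lt_top_iff (T : X →L[ℂ] X) :
    ascent T < ⊤ ↔ ∃ n : ℕ, (T ^ n).ker = (T ^ (n + 1)).ker := by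
  simp [ascent, iInf_lt_iff]

theorem descent_lt_top_iff (T : X →L[ℂ] X) :
    descent T < ⊤ ↔ ∃ n : ℕ, (T ^ n).range = (T ^ (n + 1)).range := by
  simp [descent, iInf_lt_iff]

theorem surjective_pow {T : X →L[ℂ] X} (h : Function.Surjective T) (n : ℕ) :
    Function.Surjective (T ^ n) := by
  rw [FunLike.coe_pow_eq_iterate]
  exact h.iterate n

theorem injective_pow {T : X →L[ℂ] X} (h : Function.Injective T) (n : ℕ) :
    Function.Injective (T ^ n) := by
  rw [FunLike.coe_pow_eq_iterate]
  exact h.iterate n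

/-- If `y = Tⁿ x` lies in `N(T)`, then `x ∈ N(Tⁿ⁺¹) = N(Tⁿ)`, so `y = 0`. -/
theorem injective_of_surjective_of_ascent_lt_top {T : X →L[ℂ] X} (hT : Function.Surjective T)
    (h : ascent T < ⊤) : Function.Injective T := by
  obtain ⟨n, hn⟩ := (ascent_lt_top_iff T).1 h
  refine (injective_iff_map_eq_zero T).2 fun y hy => ?_
  obtain ⟨x, rfl⟩ := surjective_pow hT n y
  have hx : x ∈ (T ^ (n + 1)).ker := by
    rw [LinearMap.mem_ker, pow_succ']
    exact hy
  rw [← hn] at hx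
  exact hx

/-- Write `Tⁿ y = Tⁿ⁺¹ x` and cancel the injective `Tⁿ`. -/
theorem surjective_of_injective_of_descent_lt_top {T : X →L[ℂ] X} (hT : Function.Injective T)
    (h : descent T < ⊤) : Function.Surjective T := by
  obtain ⟨n, hn⟩ := (descent_lt_top_iff T).1 h
  intro y
  have hy : (T ^ n) y ∈ (T ^ n).range := ⟨y, rfl⟩
  rw [hn] at hy
  obtain ⟨x, hx⟩ := hy
  refine ⟨x, injective_pow hT n ?_⟩
  rw [← hx, pow_succ]
  rfl

theorem nullity_eq_zero_of_injective {T : X →L[ℂ] X} (hT : Function.Injective T) :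
    nullity T = 0 := by
  have : T.ker = ⊥ := LinearMap.ker_eq_bot.2 hT
  rw [nullity, this]
  simp

theorem defect_eq_zero_of_surjective {T : X →L[ℂ] X} (hT : Function.Surjective T) :
    defect T = 0 := by
  have : T.range = ⊤ := LinearMap.range_eq_top.2 hT
  rw [defect, this]
  simp

theorem isClosed_range_of_surjective {T : X →L[ℂ] X} (hT : Function.Surjective T) :
    IsClosed (T.range : Set X) := by
  have : T.range = ⊤ := LinearMap.range_eq_top.2 hT
  rw [this]
  exact isClosed_univ

theorem ascent_lt_top_of_injective {T : X →L[ℂ] X} (hT : Function.Injective T) :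
    ascent T < ⊤ := by
  refine (ascent_lt_top_iff T).2 ⟨0, ?_⟩
  have h (n : ℕ) : (T ^ n).ker = ⊥ := LinearMap.ker_eq_bot.2 (injective_pow hT n)
  rw [h, h]

theorem isUpperSemiFredholm_of_bijective {T : X →L[ℂ] X} (hT : Function.Bijective T) :
    IsUpperSemiFredholm T :=
  ⟨isClosed_range_of_surjective hT.2, by simp [nullity_eq_zero_of_injective hT.1]⟩

theorem isUpperSemiWeyl_of_bijective {T : X →L[ℂ] X} (hT : Function.Bijective T) :
    IsUpperSemiWeyl T :=
  ⟨isUpperSemiFredholm_of_bijective hT, by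
    simp [extIndex, nullity_eq_zero_of_injective hT.1, defect_eq_zero_of_surjective hT.2]⟩

theorem isUpperSemiBrowder_of_bijective {T : X →L[ℂ] X} (hT : Function.Bijective T) :
    IsUpperSemiBrowder T :=
  ⟨isUpperSemiFredholm_of_bijective hT, ascent_lt_top_of_injective hT.1⟩

theorem isFredholm_of_bijective [CompleteSpace X] {T : X →L[ℂ] X} (hT : Function.Bijective T) :
    T.IsFredholm :=
  (isFredholm_iff T).2 ⟨isUpperSemiFredholm_of_bijective hT, by
    simp [IsLowerSemiFredholm, defect_eq_zero_of_surjective hT.2]⟩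

/-- Subtracting `⊤` in `EReal` gives `⊥` whatever the nullity; this is how `S` masks the positive
index of `L - z`. -/
theorem isUpperSemiWeyl_of_defect_eq_top {T : X →L[ℂ] X} (hT : IsUpperSemiFredholm T)
    (h : defect T = ⊤) : IsUpperSemiWeyl T :=
  ⟨hT, by simp [extIndex, h, EReal.sub_top]⟩

theorem not_isUpperSemiWeyl_of_surjective {T : X →L[ℂ] X} (hT : Function.Surjective T)
    (h : ¬ Function.Injective T) : ¬ IsUpperSemiWeyl T := by
  rintro ⟨-, hi⟩
  rw [extIndex, defect_eq_zero_of_surjective hT] at hi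
  have h0 : nullity T = 0 := by
    simp only [ENat.toENNReal_zero, EReal.coe_ennreal_zero, sub_zero] at hi
    rw [← EReal.coe_ennreal_zero, EReal.coe_ennreal_le_coe_ennreal_iff, nonpos_iff_eq_zero,
      ENat.toENNReal_eq_zero] at hi
    exact hi
  rw [nullity, Cardinal.toENat_eq_zero, Submodule.rank_eq_zero] at h0
  exact h (LinearMap.ker_eq_bot.1 h0)

end General

/-! ### Kernels, ranges, ascent and descent of direct sums -/

section DirectSum

variable {X Y : Type*} [NormedAddCommGroup X] [NormedSpace ℂ X]
  [NormedAddCommGroup Y] [NormedSpace ℂ Y] (A : X →L[ℂ] X) (B : Y →L[ℂ] Y)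

theorem directSum_apply (u : WithLp 2 (X × Y)) :
    directSum A B u = WithLp.toLp 2 (A u.fst, B u.snd) := rfl

theorem directSum_pow (n : ℕ) : directSum A B ^ n = directSum (A ^ n) (B ^ n) := by
  induction n with
  | zero => rfl
  | succ n ih => rw [pow_succ, ih, pow_succ, pow_succ]; rfl

theorem mem_ker_directSum (u : WithLp 2 (X × Y)) :
    u ∈ (directSum A B).ker ↔ u.fst ∈ A.ker ∧ u.snd ∈ B.ker := by
  simp [LinearMap.mem_ker, directSum_apply, WithLp.toLp_eq_zero]

theorem mem_range_directSum (u : WithLp 2 (X × Y)) :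
    u ∈ (directSum A B).range ↔ u.fst ∈ A.range ∧ u.snd ∈ B.range := by
  constructor
  · rintro ⟨v, rfl⟩
    exact ⟨⟨v.fst, rfl⟩, ⟨v.snd, rfl⟩⟩
  · rintro ⟨⟨x, hx⟩, ⟨y, hy⟩⟩
    refine ⟨WithLp.toLp 2 (x, y), ?_⟩
    change WithLp.toLp 2 (A x, B y) = u
    change A x = _ at hx
    change B y = _ at hy
    rw [hx, hy]
    rfl

variable {A B}

theorem bijective_directSum (hA : Function.Bijective A) (hB : Function.Bijective B) :
    Function.Bijective (directSum A B) :=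
  (WithLp.equiv 2 (X × Y)).symm.bijective.comp
    ((hA.prodMap hB).comp (WithLp.equiv 2 (X × Y)).bijective)

theorem isClosed_range_directSum (hA : IsClosed (A.range : Set X))
    (hB : IsClosed (B.range : Set Y)) : IsClosed ((directSum A B).range : Set (WithLp 2 (X × Y))) := by
  have : ((directSum A B).range : Set (WithLp 2 (X × Y))) =
      WithLp.ofLp ⁻¹' ((A.range : Set X) ×ˢ (B.range : Set Y)) := by
    ext u
    exact mem_range_directSum A B u
  rw [this]
  exact (hA.prod hB).preimage (WithLp.prod_continuous_ofLp 2 X Y)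

/-- `R(A)` is the preimage of `R(A ⊕ B)` under the continuous embedding `x ↦ (x, 0)`. The same
embedding transfers ascent and descent below. -/
theorem isClosed_range_of_directSum (h : IsClosed ((directSum A B).range : Set (WithLp 2 (X × Y)))) :
    IsClosed (A.range : Set X) := by
  have : (A.range : Set X) =
      (fun x => WithLp.toLp 2 (x, (0 : Y))) ⁻¹' ((directSum A B).range : Set (WithLp 2 (X × Y))) := by
    ext x
    exact ((mem_range_directSum A B (WithLp.toLp 2 (x, 0))).trans
      (and_iff_left B.range.zero_mem)).symm
  rw [this]
  exact h.preimage ((WithLp.prod_continuous_toLp 2 X Y).comp (by fun_prop))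

theorem ascent_lt_top_of_directSum (h : ascent (directSum A B) < ⊤) : ascent A < ⊤ := by
  obtain ⟨n, hn⟩ := (ascent_lt_top_iff _).1 h
  refine (ascent_lt_top_iff _).2 ⟨n, ?_⟩
  have key (m : ℕ) (x : X) :
      x ∈ (A ^ m).ker ↔ WithLp.toLp 2 (x, (0 : Y)) ∈ (directSum A B ^ m).ker := by
    rw [directSum_pow, mem_ker_directSum]
    exact (and_iff_left (zero_mem _)).symm
  ext x
  rw [key, key, hn]

theorem descent_lt_top_of_directSum (h : descent (directSum A B) < ⊤) : descent A < ⊤ := by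
  obtain ⟨n, hn⟩ := (descent_lt_top_iff _).1 h
  refine (descent_lt_top_iff _).2 ⟨n, ?_⟩
  have key (m : ℕ) (x : X) :
      x ∈ (A ^ m).range ↔ WithLp.toLp 2 (x, (0 : Y)) ∈ (directSum A B ^ m).range := by
    rw [directSum_pow, mem_range_directSum]
    exact (and_iff_left (zero_mem _)).symm
  ext x
  rw [key, key, hn]

/-- Injectivity of `B` kills the second coordinate, so the kernel of the sum embeds in that of `A`.
-/
theorem nullity_directSum_lt_top (hA : FiniteDimensional ℂ A.ker) (hB : Function.Injective B) :
    nullity (directSum A B) < ⊤ := by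
  rw [nullity_lt_top_iff]
  let f : (directSum A B).ker →ₗ[ℂ] A.ker :=
    { toFun := fun u => ⟨u.1.fst, ((mem_ker_directSum A B u.1).1 u.2).1⟩
      map_add' := fun _ _ => rfl
      map_smul' := fun _ _ => rfl }
  refine FiniteDimensional.of_injective f ((injective_iff_map_eq_zero f).2 fun u hu => ?_)
  have h1 : u.1.fst = 0 := congrArg Subtype.val hu
  have h2 : u.1.snd = 0 :=
    (injective_iff_map_eq_zero B).1 hB _ ((mem_ker_directSum A B u.1).1 u.2).2
  exact Subtype.ext ((WithLp.ofLp_injective 2) (Prod.ext h1 h2))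

/-- The quotient by `R(A ⊕ B)` maps onto `Y ⧸ R(B)`. -/
theorem defect_directSum_eq_top (hB : defect B = ⊤) : defect (directSum A B) = ⊤ := by
  by_contra h
  have hfin := (defect_lt_top_iff _).1 (lt_top_iff_ne_top.2 h)
  refine ((defect_lt_top_iff B).2 ?_).ne hB
  let g : WithLp 2 (X × Y) →ₗ[ℂ] Y ⧸ B.range :=
    { toFun := fun u => B.range.mkQ u.snd
      map_add' := fun u v => map_add B.range.mkQ u.snd v.snd
      map_smul' := fun c u => map_smul B.range.mkQ c u.snd }
  have hg : (directSum A B).range ≤ g.ker := fun u hu =>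
    (Submodule.Quotient.mk_eq_zero _).2 ((mem_range_directSum A B u).1 hu).2
  refine Module.Finite.of_surjective ((directSum A B).range.liftQ g hg) fun q => ?_
  obtain ⟨y, rfl⟩ := B.range.mkQ_surjective q
  exact ⟨(directSum A B).range.mkQ (WithLp.toLp 2 (0, y)), rfl⟩

end DirectSum

/-! ### The left shift inside, on and outside the unit circle -/

section LeftShift

theorem shifted_leftShift_apply (z : ℂ) (x : ell2) (n : ℕ) :
    shifted leftShift z x n = x (n + 1) - z * x n := rfl

theorem norm_leftShift_le : ‖leftShift‖ ≤ 1 :=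
  LinearMap.mkContinuous_norm_le _ zero_le_one _

/-- The sequence `(0, x₁, x₂, …)`. -/
def rightShiftSeq (x : ℕ → ℂ) : ℕ → ℂ
  | 0 => 0
  | n + 1 => x n

theorem hasSum_rightShiftSeq (x : ell2) :
    HasSum (fun n => ‖rightShiftSeq x n‖ ^ (2 : ℝ≥0∞).toReal) (‖x‖ ^ (2 : ℝ≥0∞).toReal) := by
  have h := lp.hasSum_norm (p := 2) (by norm_num) x
  rw [← (add_left_injective 1).hasSum_iff]
  · exact h
  · rintro (_ | n) hn
    · simp [rightShiftSeq]
    · exact absurd ⟨n, rfl⟩ hn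

/-- The right shift on `l²`. -/
noncomputable def rightShift : ell2 →ₗᵢ[ℂ] ell2 where
  toFun x := ⟨rightShiftSeq x, memℓp_gen (hasSum_rightShiftSeq x).summable⟩
  map_add' x y := by
    ext n
    change rightShiftSeq (fun k => x k + y k) n = rightShiftSeq x n + rightShiftSeq y n
    cases n <;> simp [rightShiftSeq]
  map_smul' c x := by
    ext n
    cases n <;> simp [rightShiftSeq]
  norm_map' x := by
    have h := lp.hasSum_norm (p := 2) (by norm_num)
      (⟨rightShiftSeq x, memℓp_gen (hasSum_rightShiftSeq x).summable⟩ : ell2)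
    have h2 := h.unique (hasSum_rightShiftSeq x)
    exact (Real.rpow_left_inj (norm_nonneg _) (norm_nonneg _) (by norm_num)).1 h2

theorem leftShift_rightShift (x : ell2) : leftShift (rightShift x) = x := rfl

theorem leftShift_surjective : Function.Surjective leftShift :=
  fun x => ⟨rightShift x, leftShift_rightShift x⟩

theorem bijective_one_sub_smul {X : Type*} [NormedAddCommGroup X] [NormedSpace ℂ X]
    [CompleteSpace X] {A : X →L[ℂ] X} {z : ℂ} (hA : ‖A‖ ≤ 1) (hz : ‖z‖ < 1) :
    Function.Bijective (1 - z • A : X →L[ℂ] X) := by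
  rw [← ContinuousLinearMap.isUnit_iff_bijective]
  refine isUnit_one_sub_of_norm_lt_one ?_
  rw [norm_smul]
  nlinarith [norm_nonneg z, norm_nonneg A]

/-- With `R` the right shift, `L R = 1` gives `L - z = L (1 - z R)`, where `1 - z R` is invertible
by the Neumann series. -/
theorem surjective_shifted_leftShift {z : ℂ} (hz : ‖z‖ < 1) :
    Function.Surjective (shifted leftShift z) := by
  have h := bijective_one_sub_smul rightShift.norm_toContinuousLinearMap_le hz
  intro y
  obtain ⟨w, rfl⟩ := leftShift_surjective y
  obtain ⟨x, rfl⟩ := h.2 w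
  refine ⟨x, ?_⟩
  change leftShift x - z • x = leftShift (x - z • rightShift x)
  rw [map_sub, map_smul, leftShift_rightShift]

theorem eq_pow_mul_of_shifted_leftShift_eq_zero {z : ℂ} {x : ell2}
    (hx : shifted leftShift z x = 0) (n : ℕ) : x n = z ^ n * x 0 := by
  induction n with
  | zero => simp
  | succ n ih =>
    have h : x (n + 1) - z * x n = 0 := by
      rw [← shifted_leftShift_apply, hx]
      rfl
    rw [sub_eq_zero.1 h, ih, pow_succ']
    ring

theorem finiteDimensional_ker_shifted_leftShift (z : ℂ) :
    FiniteDimensional ℂ (shifted leftShift z).ker := by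
  let f : (shifted leftShift z).ker →ₗ[ℂ] ℂ :=
    { toFun := fun x => x.1 0
      map_add' := fun _ _ => rfl
      map_smul' := fun _ _ => rfl }
  refine FiniteDimensional.of_injective f ((injective_iff_map_eq_zero f).2 fun x hx => ?_)
  refine Subtype.ext (lp.ext (funext fun n => ?_))
  rw [eq_pow_mul_of_shifted_leftShift_eq_zero x.2 n, show x.1 0 = 0 from hx, mul_zero]
  rfl

theorem not_injective_shifted_leftShift {z : ℂ} (hz : ‖z‖ < 1) :
    ¬ Function.Injective (shifted leftShift z) := by
  have hm : Memℓp (fun n : ℕ => z ^ n) 2 := by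
    rw [memℓp_gen_iff (by norm_num)]
    have := summable_geometric_of_lt_one (sq_nonneg ‖z‖) (by nlinarith [norm_nonneg z])
    refine this.congr fun n => ?_
    simp [← pow_mul, mul_comm]
  intro h
  have h0 := (injective_iff_map_eq_zero _).1 h (⟨fun n => z ^ n, hm⟩ : ell2) (by
    refine lp.ext (funext fun n => ?_)
    change z ^ (n + 1) - z * z ^ n = 0
    ring)
  have : z ^ 0 = 0 := congrFun (congrArg Subtype.val h0) 0
  simp at this

/-- A kernel element has entries of constant modulus, and these tend to 0. -/
theorem injective_shifted_leftShift {z : ℂ} (hz : ‖z‖ = 1) :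
    Function.Injective (shifted leftShift z) := by
  refine (injective_iff_map_eq_zero _).2 fun x hx => ?_
  have hn := eq_pow_mul_of_shifted_leftShift_eq_zero hx
  have hs := (lp.hasSum_norm (p := 2) (by norm_num) x).summable.tendsto_atTop_zero
  have h0 : x 0 = 0 := by
    have : (fun n => ‖x n‖ ^ (2 : ℝ≥0∞).toReal) = fun _ => ‖x 0‖ ^ (2 : ℝ≥0∞).toReal := by
      funext n
      rw [hn n, norm_mul, norm_pow, hz, one_pow, one_mul]
    rw [this] at hs
    simpa using tendsto_const_nhds_iff.1 hs
  refine lp.ext (funext fun n => ?_)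
  rw [hn n, h0, mul_zero]
  rfl

/-- The truncated geometric sequence `(1, z, …, zⁿ⁻¹, 0, …)`. -/
noncomputable def truncatedGeometric (z : ℂ) (n : ℕ) : ell2 :=
  ∑ i ∈ Finset.range n, lp.single 2 i (z ^ i)

theorem truncatedGeometric_apply (z : ℂ) (n k : ℕ) :
    truncatedGeometric z n k = if k < n then z ^ k else 0 := by
  rw [truncatedGeometric, lp.coeFn_sum, Finset.sum_apply]
  simp [lp.single_apply, Pi.single_apply]

theorem norm_truncatedGeometric_sq {z : ℂ} (hz : ‖z‖ = 1) (n : ℕ) :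
    ‖truncatedGeometric z n‖ ^ 2 = n := by
  have := lp.norm_sum_single (E := fun _ : ℕ => ℂ) (p := 2) (by norm_num) (fun i => z ^ i)
    (Finset.range n)
  simpa [truncatedGeometric, hz] using this

/-- All terms cancel except at the cut-off index `n`, where `-zⁿ⁺¹` remains. -/
theorem norm_shifted_truncatedGeometric {z : ℂ} (hz : ‖z‖ = 1) (n : ℕ) :
    ‖shifted leftShift z (truncatedGeometric z (n + 1))‖ = 1 := by
  have h : shifted leftShift z (truncatedGeometric z (n + 1)) =
      lp.single 2 n (-z ^ (n + 1)) := by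
    refine lp.ext (funext fun k => ?_)
    rw [shifted_leftShift_apply, truncatedGeometric_apply, truncatedGeometric_apply,
      lp.single_apply, Pi.single_apply]
    rcases lt_trichotomy k n with hk | rfl | hk
    · rw [if_pos (by omega), if_pos (by omega), if_neg (by omega)]
      ring
    · rw [if_neg (by omega), if_pos (by omega), if_pos rfl]
      ring
    · rw [if_neg (by omega), if_neg (by omega), if_neg (by omega)]
      ring
  rw [h, lp.norm_single (by norm_num), norm_neg, norm_pow, hz, one_pow]

/-- An injective operator with closed range is bounded below, but the truncated geometric sequences
have unbounded norm and images of norm 1. -/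
theorem not_isClosed_range_shifted_leftShift {z : ℂ} (hz : ‖z‖ = 1) :
    ¬ IsClosed ((shifted leftShift z).range : Set ell2) := by
  intro h
  obtain ⟨K, hK⟩ := ContinuousLinearMap.antilipschitz_of_injective_of_isClosed_range _
    (injective_shifted_leftShift hz) h
  obtain ⟨n, hn⟩ := exists_nat_gt ((K : ℝ) ^ 2)
  have h1 := hK.le_mul_norm (map_zero _) (truncatedGeometric z (n + 1))
  rw [norm_shifted_truncatedGeometric hz, mul_one] at h1
  have h2 := norm_truncatedGeometric_sq hz (n + 1)
  have h3 := pow_le_pow_left₀ (norm_nonneg _) h1 2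
  rw [h2] at h3
  push_cast at h3
  linarith

theorem bijective_shifted_leftShift {z : ℂ} (hz : 1 < ‖z‖) :
    Function.Bijective (shifted leftShift z) :=
  bijective_shifted_of_norm_lt norm_leftShift_le hz

end LeftShift

/-! ### The spread isometry inside and outside the unit circle -/

section Spread

theorem bijective_shifted_spread {z : ℂ} (hz : 1 < ‖z‖) :
    Function.Bijective (shifted spread.toContinuousLinearMap z) :=
  bijective_shifted_of_norm_lt spread.norm_toContinuousLinearMap_le hz

/-- As `S` is isometric, `‖S x - z x‖ ≥ (1 - |z|) ‖x‖`. -/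
theorem antilipschitz_shifted_spread {z : ℂ} (hz : ‖z‖ < 1) :
    ∃ K, AntilipschitzWith K (shifted spread.toContinuousLinearMap z) := by
  have hpos : 0 < 1 - ‖z‖ := sub_pos.2 hz
  refine ⟨⟨(1 - ‖z‖)⁻¹, (inv_pos.2 hpos).le⟩,
    AddMonoidHomClass.antilipschitz_of_bound _ fun x => ?_⟩
  have h : ‖spread x‖ - ‖z • x‖ ≤ ‖spread x - z • x‖ := norm_sub_norm_le _ _
  rw [spread.norm_map, norm_smul] at h
  change ‖x‖ ≤ (1 - ‖z‖)⁻¹ * ‖spread x - z • x‖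
  rw [inv_mul_eq_div, le_div_iff₀ hpos]
  linarith

theorem injective_shifted_spread {z : ℂ} (hz : ‖z‖ < 1) :
    Function.Injective (shifted spread.toContinuousLinearMap z) :=
  (antilipschitz_shifted_spread hz).choose_spec.injective

theorem isClosed_range_shifted_spread {z : ℂ} (hz : ‖z‖ < 1) :
    IsClosed ((shifted spread.toContinuousLinearMap z).range : Set ell2) :=
  (antilipschitz_shifted_spread hz).choose_spec.isClosed_range
    (shifted spread.toContinuousLinearMap z).uniformContinuous

/-- The linear map `x ↦ (x₂, x₄, x₆, …)`, which vanishes on the range of `spread`. -/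
def oddPart : ell2 →ₗ[ℂ] (ℕ → ℂ) where
  toFun x n := x (2 * n + 1)
  map_add' _ _ := rfl
  map_smul' _ _ := rfl

theorem oddPart_spread (x : ell2) : oddPart (spread x) = 0 := by
  funext n
  change spread x (2 * n + 1) = 0
  rw [spread_apply, if_neg (by simp)]

theorem oddPart_single (n : ℕ) :
    oddPart (lp.single 2 (2 * n + 1) 1) = Pi.single n 1 := by
  funext k
  change lp.single (E := fun _ : ℕ => ℂ) 2 (2 * n + 1) 1 (2 * k + 1) = _
  simp [lp.single_apply, Pi.single_apply]

/-- `oddPart` factors through the quotient by `R(S)` and sends the classes of the odd-indexed unit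
vectors to an independent family. -/
theorem defect_spread_eq_top : defect spread.toContinuousLinearMap = ⊤ := by
  by_contra h
  have hfin := (defect_lt_top_iff _).1 (lt_top_iff_ne_top.2 h)
  have hle : spread.toContinuousLinearMap.range ≤ oddPart.ker := by
    rintro _ ⟨x, rfl⟩
    exact oddPart_spread x
  let v (n : ℕ) : ell2 ⧸ spread.toContinuousLinearMap.range :=
    Submodule.Quotient.mk (lp.single 2 (2 * n + 1) 1)
  have hv : LinearIndependent ℂ v := by
    refine LinearIndependent.of_comp (Submodule.liftQ _ oddPart hle) ?_
    have hc : Submodule.liftQ _ oddPart hle ∘ v = fun n => Pi.single n 1 :=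
      funext oddPart_single
    rw [hc]
    exact Pi.linearIndependent_single_one ℕ ℂ
  exact Set.infinite_univ (Set.finite_univ_iff.2 hv.finite)

theorem defect_comp_of_bijective {X : Type*} [NormedAddCommGroup X] [NormedSpace ℂ X]
    {U A : X →L[ℂ] X} (hU : Function.Bijective U) : defect (U ∘L A) = defect A := by
  let e : X ≃ₗ[ℂ] X := LinearEquiv.ofBijective U.toLinearMap hU
  have h : A.range.map (e : X →ₗ[ℂ] X) = (U ∘L A).range :=
    (LinearMap.range_comp A.toLinearMap U.toLinearMap).symm
  rw [defect, defect, (Submodule.Quotient.equiv _ _ e h).rank_eq]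

/-- Rests on `S* S = 1`. For |z| < 1 the left factor is invertible, so `S - z` inherits the infinite
defect of `S`. -/
theorem shifted_spread_eq_comp (z : ℂ) :
    shifted spread.toContinuousLinearMap z =
      (1 - z • ContinuousLinearMap.adjoint spread.toContinuousLinearMap) ∘L
        spread.toContinuousLinearMap := by
  have h : ContinuousLinearMap.adjoint spread.toContinuousLinearMap ∘L
      spread.toContinuousLinearMap = 1 :=
    (ContinuousLinearMap.norm_map_iff_adjoint_comp_self _).1 spread.norm_map
  ext1 x
  have hx := congrArg (fun A : ell2 →L[ℂ] ell2 => A x) h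
  change spread x - z • x = spread x - z • ContinuousLinearMap.adjoint
    spread.toContinuousLinearMap (spread x)
  exact congrArg (fun y => spread x - z • y) hx.symm

theorem defect_shifted_spread_eq_top {z : ℂ} (hz : ‖z‖ < 1) :
    defect (shifted spread.toContinuousLinearMap z) = ⊤ := by
  rw [shifted_spread_eq_comp, defect_comp_of_bijective, defect_spread_eq_top]
  refine bijective_one_sub_smul ?_ hz
  rw [LinearIsometryEquiv.norm_map]
  exact spread.norm_toContinuousLinearMap_le

end Spread

/-! ### The spectra of `T` and membership in the two classes -/

section Spectra

theorem setOf_not_eq_closedBall {p : ℂ → Prop} (h1 : ∀ z : ℂ, ‖z‖ < 1 → ¬ p z)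
    (h2 : ∀ z : ℂ, ‖z‖ = 1 → ¬ p z) (h3 : ∀ z : ℂ, 1 < ‖z‖ → p z) :
    {z | ¬ p z} = Metric.closedBall 0 1 := by
  ext z
  rw [mem_closedBall_zero_iff]
  exact ⟨fun hz => not_lt.1 fun h => hz (h3 z h), fun hz => hz.lt_or_eq.elim (h1 z) (h2 z)⟩

theorem setOf_not_eq_sphere {p : ℂ → Prop} (h1 : ∀ z : ℂ, ‖z‖ < 1 → p z)
    (h2 : ∀ z : ℂ, ‖z‖ = 1 → ¬ p z) (h3 : ∀ z : ℂ, 1 < ‖z‖ → p z) :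
    {z | ¬ p z} = Metric.sphere 0 1 := by
  ext z
  rw [mem_sphere_zero_iff_norm]
  refine ⟨fun hz => ?_, h2 z⟩
  by_contra h
  exact hz ((lt_or_gt_of_ne h).elim (h1 z) (h3 z))

theorem shifted_exampleT (z : ℂ) : shifted exampleT z =
    directSum (shifted leftShift z) (shifted spread.toContinuousLinearMap z) := rfl

theorem bijective_shifted_exampleT {z : ℂ} (hz : 1 < ‖z‖) :
    Function.Bijective (shifted exampleT z) := by
  rw [shifted_exampleT]
  exact bijective_directSum (bijective_shifted_leftShift hz) (bijective_shifted_spread hz)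

theorem isUpperSemiFredholm_shifted_exampleT {z : ℂ} (hz : ‖z‖ < 1) :
    IsUpperSemiFredholm (shifted exampleT z) := by
  rw [shifted_exampleT]
  exact ⟨isClosed_range_directSum (isClosed_range_of_surjective (surjective_shifted_leftShift hz))
      (isClosed_range_shifted_spread hz),
    nullity_directSum_lt_top (finiteDimensional_ker_shifted_leftShift z)
      (injective_shifted_spread hz)⟩

theorem defect_shifted_exampleT {z : ℂ} (hz : ‖z‖ < 1) : defect (shifted exampleT z) = ⊤ := by
  rw [shifted_exampleT]
  exact defect_directSum_eq_top (defect_shifted_spread_eq_top hz)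

theorem not_isUpperSemiFredholm_shifted_exampleT {z : ℂ} (hz : ‖z‖ = 1) :
    ¬ IsUpperSemiFredholm (shifted exampleT z) := by
  rw [shifted_exampleT]
  exact fun h => not_isClosed_range_shifted_leftShift hz (isClosed_range_of_directSum h.1)

theorem not_ascent_shifted_leftShift_lt_top {z : ℂ} (hz : ‖z‖ < 1) :
    ¬ ascent (shifted leftShift z) < ⊤ := fun h =>
  not_injective_shifted_leftShift hz
    (injective_of_surjective_of_ascent_lt_top (surjective_shifted_leftShift hz) h)

theorem not_descent_shifted_leftShift_lt_top {z : ℂ} (hz : ‖z‖ = 1) :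
    ¬ descent (shifted leftShift z) < ⊤ := fun h =>
  not_isClosed_range_shifted_leftShift hz (isClosed_range_of_surjective
    (surjective_of_injective_of_descent_lt_top (injective_shifted_leftShift hz) h))

theorem not_ascent_shifted_exampleT_lt_top {z : ℂ} (hz : ‖z‖ < 1) :
    ¬ ascent (shifted exampleT z) < ⊤ := by
  rw [shifted_exampleT]
  exact fun h => not_ascent_shifted_leftShift_lt_top hz (ascent_lt_top_of_directSum h)

theorem not_descent_shifted_exampleT_lt_top {z : ℂ} (hz : ‖z‖ = 1) :
    ¬ descent (shifted exampleT z) < ⊤ := by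
  rw [shifted_exampleT]
  exact fun h => not_descent_shifted_leftShift_lt_top hz (descent_lt_top_of_directSum h)

theorem not_isFredholm_shifted_exampleT {z : ℂ} (hz : ‖z‖ ≤ 1) :
    ¬ (shifted exampleT z).IsFredholm := by
  rw [isFredholm_iff]
  rintro ⟨hu, hl⟩
  rcases hz.lt_or_eq with hz | hz
  · exact hl.ne (defect_shifted_exampleT hz)
  · exact not_isUpperSemiFredholm_shifted_exampleT hz hu

theorem spectrum_exampleT : spectrum ℂ exampleT = Metric.closedBall 0 1 := by
  ext z
  rw [mem_spectrum_iff, mem_closedBall_zero_iff]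
  refine ⟨fun hz => not_lt.1 fun h => hz (bijective_shifted_exampleT h), fun hz hb => ?_⟩
  exact not_isFredholm_shifted_exampleT hz (isFredholm_of_bijective hb)

theorem essSpectrum_exampleT : essSpectrum exampleT = Metric.closedBall 0 1 :=
  setOf_not_eq_closedBall (p := fun z => (shifted exampleT z).IsFredholm)
    (fun _ hz => not_isFredholm_shifted_exampleT hz.le)
    (fun _ hz => not_isFredholm_shifted_exampleT hz.le)
    fun _ hz => isFredholm_of_bijective (bijective_shifted_exampleT hz)

theorem upperSemiBrowderSpectrum_exampleT :
    upperSemiBrowderSpectrum exampleT = Metric.closedBall 0 1 :=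
  setOf_not_eq_closedBall (p := fun z => IsUpperSemiBrowder (shifted exampleT z))
    (fun _ hz h => not_ascent_shifted_exampleT_lt_top hz h.2)
    (fun _ hz h => not_isUpperSemiFredholm_shifted_exampleT hz h.1)
    fun _ hz => isUpperSemiBrowder_of_bijective (bijective_shifted_exampleT hz)

theorem upperSemiFredholmSpectrum_exampleT :
    upperSemiFredholmSpectrum exampleT = Metric.sphere 0 1 :=
  setOf_not_eq_sphere (p := fun z => IsUpperSemiFredholm (shifted exampleT z))
    (fun _ hz => isUpperSemiFredholm_shifted_exampleT hz)
    (fun _ hz => not_isUpperSemiFredholm_shifted_exampleT hz)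
    fun _ hz => isUpperSemiFredholm_of_bijective (bijective_shifted_exampleT hz)

theorem upperSemiWeylSpectrum_exampleT :
    upperSemiWeylSpectrum exampleT = Metric.sphere 0 1 :=
  setOf_not_eq_sphere (p := fun z => IsUpperSemiWeyl (shifted exampleT z))
    (fun _ hz => isUpperSemiWeyl_of_defect_eq_top (isUpperSemiFredholm_shifted_exampleT hz)
      (defect_shifted_exampleT hz))
    (fun _ hz h => not_isUpperSemiFredholm_shifted_exampleT hz h.1)
    fun _ hz => isUpperSemiWeyl_of_bijective (bijective_shifted_exampleT hz)

theorem exampleT_mem_classBe : exampleT ∈ classBe (WithLp 2 (ell2 × ell2)) := by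
  change spectrum ℂ exampleT \ essSpectrum exampleT = polesFiniteRank exampleT
  -- The two spectra coincide, so it remains to show that there are no poles: the ascent is infinite
  -- inside the disc, the descent on the circle.
  rw [essSpectrum_exampleT, ← spectrum_exampleT, Set.sdiff_self, eq_comm,
    Set.eq_empty_iff_forall_notMem]
  rintro z ⟨⟨hz, ha, hd⟩, -⟩
  rw [spectrum_exampleT, mem_closedBall_zero_iff] at hz
  rcases hz.lt_or_eq with hz | hz
  · exact not_ascent_shifted_exampleT_lt_top hz ha
  · exact not_descent_shifted_exampleT_lt_top hz hd

theorem exampleT_notMem_classAB : exampleT ∉ classAB (WithLp 2 (ell2 × ell2)) := by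
  intro h
  change upperSemiWeylSpectrum exampleT = upperSemiBrowderSpectrum exampleT at h
  rw [upperSemiWeylSpectrum_exampleT, upperSemiBrowderSpectrum_exampleT] at h
  have h0 : (0 : ℂ) ∈ Metric.sphere (0 : ℂ) 1 := h ▸ Metric.mem_closedBall_self zero_le_one
  simp at h0

theorem leftShift_mem_classAB : leftShift ∈ classAB ell2 := by
  change upperSemiWeylSpectrum leftShift = upperSemiBrowderSpectrum leftShift
  trans Metric.closedBall 0 1
  · exact setOf_not_eq_closedBall (p := fun z => IsUpperSemiWeyl (shifted leftShift z))
      (fun _ hz => not_isUpperSemiWeyl_of_surjective (surjective_shifted_leftShift hz)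
        (not_injective_shifted_leftShift hz))
      (fun _ hz h => not_isClosed_range_shifted_leftShift hz h.1.1)
      fun _ hz => isUpperSemiWeyl_of_bijective (bijective_shifted_leftShift hz)
  · symm
    exact setOf_not_eq_closedBall (p := fun z => IsUpperSemiBrowder (shifted leftShift z))
      (fun _ hz h => not_ascent_shifted_leftShift_lt_top hz h.2)
      (fun _ hz h => not_isClosed_range_shifted_leftShift hz h.1.1)
      fun _ hz => isUpperSemiBrowder_of_bijective (bijective_shifted_leftShift hz)

/-- The point 0 separates the two sets: `L` is onto with finite-dimensional nonzero kernel, but has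
infinite ascent. -/
theorem leftShift_notMem_classBe : leftShift ∉ classBe ell2 := by
  intro h
  have h0 : ‖(0 : ℂ)‖ < 1 := by simp
  have hs := surjective_shifted_leftShift h0
  have hmem : (0 : ℂ) ∈ spectrum ℂ leftShift \ essSpectrum leftShift := by
    refine ⟨(mem_spectrum_iff _ _).2 fun hb => not_injective_shifted_leftShift h0 hb.1,
      not_not.2 ((isFredholm_iff _).2 ⟨⟨isClosed_range_of_surjective hs, ?_⟩, ?_⟩)⟩
    · exact (nullity_lt_top_iff _).2 (finiteDimensional_ker_shifted_leftShift 0)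
    · simp [IsLowerSemiFredholm, defect_eq_zero_of_surjective hs]
  rw [show spectrum ℂ leftShift \ essSpectrum leftShift = polesFiniteRank leftShift from h] at hmem
  exact not_ascent_shifted_leftShift_lt_top h0 hmem.1.2.1

theorem not_finiteDimensional_of_defect_eq_top {X : Type*} [NormedAddCommGroup X]
    [NormedSpace ℂ X] {A : X →L[ℂ] X} (hA : defect A = ⊤) : ¬ FiniteDimensional ℂ X :=
  fun _ => ((defect_lt_top_iff A).2 inferInstance).ne hA

end Spectra

end OperatorClasses

open OperatorClasses
theorem mainTheorem12 :
    (spectrum ℂ exampleT = Metric.closedBall 0 1 ∧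
      essSpectrum exampleT = Metric.closedBall 0 1 ∧
      upperSemiBrowderSpectrum exampleT = Metric.closedBall 0 1) ∧
    (upperSemiFredholmSpectrum exampleT = Metric.sphere 0 1 ∧
      upperSemiWeylSpectrum exampleT = Metric.sphere 0 1) ∧
    (exampleT ∈ classBe (WithLp 2 (ell2 × ell2)) ∧
      exampleT ∉ classAB (WithLp 2 (ell2 × ell2))) ∧
    (leftShift ∈ classAB ell2 ∧ leftShift ∉ classBe ell2) ∧
    -- neither of the two classes contains the other
    (∃ (X : Type) (_ : NormedAddCommGroup X) (_ : NormedSpace ℂ X) (_ : CompleteSpace X),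
      ¬ FiniteDimensional ℂ X ∧ ∃ A : X →L[ℂ] X, A ∈ classBe X ∧ A ∉ classAB X) ∧
    (∃ (X : Type) (_ : NormedAddCommGroup X) (_ : NormedSpace ℂ X) (_ : CompleteSpace X),
      ¬ FiniteDimensional ℂ X ∧ ∃ A : X →L[ℂ] X, A ∈ classAB X ∧ A ∉ classBe X) := by
  refine ⟨⟨spectrum_exampleT, essSpectrum_exampleT, upperSemiBrowderSpectrum_exampleT⟩,
    ⟨upperSemiFredholmSpectrum_exampleT, upperSemiWeylSpectrum_exampleT⟩,
    ⟨exampleT_mem_classBe, exampleT_notMem_classAB⟩,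
    ⟨leftShift_mem_classAB, leftShift_notMem_classBe⟩,
    ⟨_, inferInstance, inferInstance, inferInstance, ?_, exampleT, exampleT_mem_classBe,
      exampleT_notMem_classAB⟩,
    ⟨_, inferInstance, inferInstance, inferInstance, ?_, leftShift, leftShift_mem_classAB,
      leftShift_notMem_classBe⟩⟩
  · exact not_finiteDimensional_of_defect_eq_top (defect_shifted_exampleT (z := 0) (by simp))
  -- `leftShift` is onto and has defect 0, so `spread` on the same space serves as the witness.
  · exact not_finiteDimensional_of_defect_eq_top defect_spread_eq_top
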